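/- Let $k$ be a field with $\operatorname{ch}(k)\neq 2$, let $V=k[[t]]$ with order function $\mathrm{o}$, and let $A=k[[t^5,t^{11}]]\subseteq V$, that is, the subring of all power series whose exponents lie in the numerical semigroup $\langle 5,11\rangle$; put $v(A)=\{\mathrm{o}(h)\mid 0\ne h\in A\}$. An $\mathfrak m$-primary ideal $I$ of a Cohen–Macaulay local ring $(R,\mathfrak m)$ is called an Ulrich ideal if $I$ contains a parameter ideal $Q$ such that $I\neq Q$ and $I^2=QI$, and $I/I^2$ is a free $R/I$-module. We say that an ideal $I$ of $A$ possesses the data $(a,b)$ if there are $f,g\in I$ with $I=(f,g)$, $I^2=fI$, $\mathrm{o}(f)=a$, $\mathrm{o}(g)=b$, $a<b$ and $b-a\notin v(A)$. Let $\mathcal Y_A$ be the set of Ulrich ideals of $A$ which possess the data $(20,26)$. Then $$\mathcal Y_A=\Bigl\{\bigl(t^{20}+\alpha t^{21}+\beta t^{22}+\gamma t^{27}+\delta t^{33},\ t^{26}+\varepsilon t^{27}+\tau t^{33}\bigr)\ \Bigm|\ \alpha,\beta,\gamma,\delta,\varepsilon,\tau\in k,\ \varepsilon\neq\alpha,\ 3\varepsilon=2\alpha,\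 \beta=\alpha^2-2\varepsilon^2,\ \gamma=2\tau-\tfrac{55}{128}\varepsilon^7\Bigr\}.$$ -/

import Mathlib

open PowerSeries

/-! ### Ulrich ideals -/

/-- `Q` is a parameter ideal of the local ring `R`: it is generated by a system of parameters,
i.e. by `dim R` elements, and its radical is the maximal ideal. -/
def IsParameterIdeal {R : Type*} [CommRing R] [IsLocalRing R] (Q : Ideal R) : Prop :=
  (∃ (d : ℕ) (x : Fin d → R), ringKrullDim R = d ∧ Q = Ideal.span (Set.range x)) ∧
    Q.radical = IsLocalRing.maximalIdeal R

/-- An `𝔪`-primary ideal `I` of a (Cohen-Macaulay) local ring `R` is an *Ulrich ideal* if, for some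
parameter ideal `Q` contained in `I`, one has `I ≠ Q` and `I ^ 2 = Q * I` (so that `Q` is a
reduction of `I`), and `I / I ^ 2` is a free `R / I`-module. -/
structure IsUlrichIdeal {R : Type*} [CommRing R] [IsLocalRing R] (I : Ideal R) : Prop where
  radical_eq : I.radical = IsLocalRing.maximalIdeal R
  exists_parameterIdeal : ∃ Q : Ideal R, IsParameterIdeal Q ∧ Q ≤ I ∧ I ≠ Q ∧ I ^ 2 = Q * I
  free_cotangent : Module.Free (R ⧸ I) I.Cotangent

/-! ### Semigroup rings of submonoids of the natural numbers -/

/-- The semigroup ring `k[[H]] ⊆ k[[t]]` of a submonoid `H` of `ℕ`: the power series all of whose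
exponents lie in `H`. -/
def semigroupRing (k : Type*) [Field k] (H : AddSubmonoid ℕ) : Subalgebra k k⟦X⟧ where
  carrier := {f | ∀ n, n ∉ H → coeff n f = 0}
  mul_mem' := by
    intro f g hf hg n hn
    rw [coeff_mul]
    refine Finset.sum_eq_zero fun p hp => ?_
    by_cases h1 : p.1 ∈ H
    · by_cases h2 : p.2 ∈ H
      · exact absurd (Finset.HasAntidiagonal.mem_antidiagonal.1 hp ▸ H.add_mem h1 h2) hn
      · rw [hg _ h2, mul_zero]
    · rw [hf _ h1, zero_mul]
  add_mem' := by
    intro f g hf hg n hn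
    rw [map_add, hf n hn, hg n hn, add_zero]
  algebraMap_mem' := by
    intro c n hn
    have h0 : n ≠ 0 := fun h => hn (h ▸ H.zero_mem)
    rw [PowerSeries.algebraMap_apply, Algebra.algebraMap_self_apply, coeff_C, if_neg h0]

theorem mem_semigroupRing {k : Type*} [Field k] {H : AddSubmonoid ℕ} {f : k⟦X⟧} :
    f ∈ semigroupRing k H ↔ ∀ n, n ∉ H → coeff n f = 0 := Iff.rfl

/-- The semigroup ring is closed under taking inverses in `k[[t]]`. -/
theorem inv_mem_semigroupRing {k : Type*} [Field k] {H : AddSubmonoid ℕ} {f : k⟦X⟧}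
    (hf : f ∈ semigroupRing k H) : f⁻¹ ∈ semigroupRing k H := by
  intro n
  induction n using Nat.strong_induction_on with
  | _ n ih =>
    intro hn
    have h0 : n ≠ 0 := fun h => hn (h ▸ H.zero_mem)
    rw [PowerSeries.coeff_inv, if_neg h0]
    refine mul_eq_zero_of_right _ (Finset.sum_eq_zero fun p hp => ?_)
    split_ifs with hlt
    · by_cases h1 : p.1 ∈ H
      · by_cases h2 : p.2 ∈ H
        · exact absurd (Finset.HasAntidiagonal.mem_antidiagonal.1 hp ▸ H.add_mem h1 h2) hn
        · rw [ih _ hlt h2, mul_zero]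
      · rw [mem_semigroupRing.1 hf _ h1, zero_mul]
    · rfl

theorem isUnit_semigroupRing {k : Type*} [Field k] {H : AddSubmonoid ℕ} (a : semigroupRing k H)
    (ha : constantCoeff (a : k⟦X⟧) ≠ 0) : IsUnit a :=
  IsUnit.of_mul_eq_one ⟨(a : k⟦X⟧)⁻¹, inv_mem_semigroupRing a.2⟩
    (Subtype.ext (PowerSeries.mul_inv_cancel (a : k⟦X⟧) ha))

instance semigroupRing_isLocalRing (k : Type*) [Field k] (H : AddSubmonoid ℕ) :
    IsLocalRing (semigroupRing k H) := by
  refine IsLocalRing.of_isUnit_or_isUnit_one_sub_self fun a => ?_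
  by_cases h : constantCoeff (a : k⟦X⟧) = 0
  · refine Or.inr (isUnit_semigroupRing _ ?_)
    have h1 : ((1 - a : semigroupRing k H) : k⟦X⟧) = 1 - (a : k⟦X⟧) := rfl
    rw [h1, map_sub, h, map_one, sub_zero]
    exact one_ne_zero
  · exact Or.inl (isUnit_semigroupRing _ h)

/-! ### The numerical data of a two-generated ideal -/

/-- The value set `v(A) ⊆ ℕ` of a subalgebra `A` of `k[[t]]`: the orders of its nonzero
elements. -/
def valueSet {k : Type*} [Field k] (A : Subalgebra k k⟦X⟧) : Set ℕ :=
  {n | ∃ h ∈ A, h.order = n}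

/-- The ideal `I` of `A ⊆ k[[t]]` *possesses the data* `(a, b)`: there are `f, g ∈ I` with
`I = (f, g)` and `I ^ 2 = f I`, of orders `a = o(f) < b = o(g)`, normalised so that `b - a` is not
the order of an element of `A`. -/
def PossessesData {k : Type*} [Field k] {A : Subalgebra k k⟦X⟧} (I : Ideal A) (a b : ℕ) : Prop :=
  ∃ f g : A, I = Ideal.span {f, g} ∧ I ^ 2 = Ideal.span {f} * I ∧
    (f : k⟦X⟧).order = a ∧ (g : k⟦X⟧).order = b ∧ a < b ∧ b - a ∉ valueSet A

/-! Everything is decided by the gaps of the symmetric semigroup H = ⟨5,11⟩, whose largest gap is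
39.

Necessity. Write F = f/t^20, G = g/t^26, with linear coefficients a, e, and let b be the quadratic
coefficient of F. The condition I² = fI puts w = g²/f = t^32·G²/F in I, so w = rf + tg with r, t in
A. Since 34 is a gap, b = (a - e)²; comparing low coefficients of rf + tg with those of w gives a ≠
e and b = (2e - a)(a - e). Hence a = 3s, e = 2s, b = s² with s = a - e ≠ 0
(`leadingTerms_of_sq_eq`). From these leading terms alone, I contains elements of orders 20, 26, 32,
38, 44, and so of every order in H except possibly 0, 5, 10, 11, 15, 16, 21, 22, 27, 33 (`hasLead`).
Clearing coefficients modulo I leaves t^27, t^33 in the tail of f and t^33 in the tail of g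
(`exists_normalForm`). The gap 39 of w then gives the last equation, γ = 2τ - 55s^7, where ε = 2s
(`coeff_seven`).

Sufficiency. For generators in normal form the same equations make w vanish at the gaps 34 and 39,
so w lies in A, and even in I, whence I² = fI (`sq_eq`). Freeness of I/I² follows from (f) : I ⊆ I,
a Gorenstein duality: each exceptional order n above is matched with the order 59 - n in I, and 59 -
20 = 39 is not an order in A (`mem_of_mul_mem`). -/

/-- Since 11 ≡ 1 mod 5, the least element of ⟨5,11⟩ in the residue class b < 5 is 11b. The gaps are
thus the n with n < 11 * (n % 5), a form that `omega` decides. -/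
theorem mem_closure_five_eleven {n : ℕ} :
    n ∈ AddSubmonoid.closure ({5, 11} : Set ℕ) ↔ 11 * (n % 5) ≤ n := by
  rw [AddSubmonoid.mem_closure_pair]
  constructor
  · rintro ⟨a, b, rfl⟩
    have h1 : (a * 5 + b * 11) % 5 = b % 5 := by omega
    have h2 := Nat.mod_le b 5
    simp only [smul_eq_mul, h1]
    omega
  · intro h
    refine ⟨(n - 11 * (n % 5)) / 5, n % 5, ?_⟩
    simp only [smul_eq_mul]
    omega

/-! ### Gaps, orders in an ideal, and clearing coefficients modulo it -/

/-- The ring `k[[t ^ 5, t ^ 11]]`. -/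
abbrev FiveEleven (k : Type*) [Field k] : Subalgebra k k⟦X⟧ :=
  semigroupRing k (AddSubmonoid.closure {5, 11})

namespace FiveEleven

variable {k : Type*} [Field k]

theorem coeff_eq_zero (p : FiveEleven k) {n : ℕ} (h : n < 11 * (n % 5)) :
    coeff n (p : k⟦X⟧) = 0 :=
  p.2 n fun hn => absurd (mem_closure_five_eleven.1 hn) (by omega)

theorem mem_of_coeff {p : k⟦X⟧} (h : ∀ n, n < 11 * (n % 5) → coeff n p = 0) :
    p ∈ FiveEleven k :=
  fun n hn => h n (by rw [mem_closure_five_eleven] at hn; omega)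

/-- 40 = (5 - 1)(11 - 1) is the conductor of the semigroup. -/
theorem X_pow_mul_mem {n : ℕ} (hn : 40 ≤ n) (p : k⟦X⟧) : X ^ n * p ∈ FiveEleven k :=
  mem_of_coeff fun m hm => by
    rw [coeff_X_pow_mul', if_neg (by omega)]

/-- The monomial `t ^ n` as an element of `k[[t ^ 5, t ^ 11]]`. -/
noncomputable def mono (k : Type*) [Field k] (n : ℕ) (h : 11 * (n % 5) ≤ n) : FiveEleven k :=
  ⟨X ^ n, mem_of_coeff fun m hm => by
    rw [coeff_X_pow, if_neg]; rintro rfl; omega⟩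

theorem coe_mono (n : ℕ) (h : 11 * (n % 5) ≤ n) : (mono k n h : k⟦X⟧) = X ^ n := rfl

theorem coeff_mono_mul (n : ℕ) (h : 11 * (n % 5) ≤ n) (p : FiveEleven k) (m : ℕ) :
    coeff m ((mono k n h * p : FiveEleven k) : k⟦X⟧) =
      if n ≤ m then coeff (m - n) (p : k⟦X⟧) else 0 := by
  rw [MulMemClass.coe_mul, coe_mono, coeff_X_pow_mul']

/-- `n` is the order of an element of `I` (normalised to have leading coefficient `1`). -/
def HasLead (I : Ideal (FiveEleven k)) (n : ℕ) : Prop :=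
  ∃ e ∈ I, (∀ m < n, coeff m (e : k⟦X⟧) = 0) ∧ coeff n (e : k⟦X⟧) = 1

theorem HasLead.add {I : Ideal (FiveEleven k)} {n : ℕ} (hn : HasLead I n) (m : ℕ)
    (hm : 11 * (m % 5) ≤ m) : HasLead I (m + n) := by
  obtain ⟨e, he, h0, h1⟩ := hn
  refine ⟨mono k m hm * e, I.mul_mem_left _ he, fun j hj => ?_, ?_⟩
  · rw [coeff_mono_mul]
    split_ifs
    · exact h0 _ (by omega)
    · rfl
  · rw [coeff_mono_mul, if_pos (by omega), Nat.add_sub_cancel_left, h1]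

theorem eq_X_pow_mul {p : k⟦X⟧} {n : ℕ} (h : ∀ m < n, coeff m p = 0) :
    ∃ q : k⟦X⟧, p = X ^ n * q ∧ ∀ j, coeff j q = coeff (n + j) p := by
  obtain ⟨q, rfl⟩ := X_pow_dvd_iff.2 h
  exact ⟨q, rfl, fun j => by rw [add_comm, coeff_X_pow_mul]⟩

/-- Every series of order at least `o(f) + 40` is a multiple of `f`. -/
theorem mem_span_of_order {f p : FiveEleven k} {n : ℕ} (h0 : ∀ m < n, coeff m (f : k⟦X⟧) = 0)
    (h1 : coeff n (f : k⟦X⟧) ≠ 0) (hp : ∀ m < n + 40, coeff m (p : k⟦X⟧) = 0) :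
    p ∈ Ideal.span {f} := by
  obtain ⟨F, hF, hFc⟩ := eq_X_pow_mul h0
  obtain ⟨P, hP, -⟩ := eq_X_pow_mul hp
  have hF0 : constantCoeff F ≠ 0 := by
    rw [← coeff_zero_eq_constantCoeff_apply, hFc]; exact h1
  rw [Ideal.mem_span_singleton]
  refine ⟨⟨X ^ 40 * (F⁻¹ * P), X_pow_mul_mem le_rfl _⟩, Subtype.ext ?_⟩
  rw [MulMemClass.coe_mul, hF, hP]
  linear_combination (- X ^ n * X ^ 40 * P) * PowerSeries.mul_inv_cancel F hF0

theorem mem_of_order {I : Ideal (FiveEleven k)} {n : ℕ} (hI : HasLead I n) {p : FiveEleven k}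
    (hp : ∀ m < n + 40, coeff m (p : k⟦X⟧) = 0) : p ∈ I := by
  obtain ⟨e, he, h0, h1⟩ := hI
  exact (Ideal.span_singleton_le_iff_mem _).2 he
    (mem_span_of_order h0 (by rw [h1]; exact one_ne_zero) hp)

theorem coe_smul (c : k) (p : FiveEleven k) : ((c • p : FiveEleven k) : k⟦X⟧) = c • (p : k⟦X⟧) :=
  rfl

/-- Modulo `I`, all coefficients of `p` from index `a` on that are orders of elements of `I` can be
cleared. -/
theorem exists_reduction {I : Ideal (FiveEleven k)} {N : ℕ} (hN : HasLead I N)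
    (p : FiveEleven k) (a : ℕ) :
    ∃ q ∈ I, (∀ m < a, coeff m (q : k⟦X⟧) = 0) ∧
      ∀ n, a ≤ n → HasLead I n → coeff n ((p - q : FiveEleven k) : k⟦X⟧) = 0 := by
  have key : ∀ j, ∃ q ∈ I, (∀ m < a, coeff m (q : k⟦X⟧) = 0) ∧
      ∀ n, a ≤ n → n < j → HasLead I n → coeff n ((p - q : FiveEleven k) : k⟦X⟧) = 0 := by
    intro j
    induction j with
    | zero => exact ⟨0, I.zero_mem, fun m _ => by simp, fun n _ h => absurd h (by omega)⟩
    | succ j ih =>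
      obtain ⟨q, hq, hqa, hqj⟩ := ih
      by_cases hj : a ≤ j ∧ HasLead I j
      · obtain ⟨e, he, h0, h1⟩ := hj.2
        refine ⟨q + coeff j ((p - q : FiveEleven k) : k⟦X⟧) • e,
          I.add_mem hq (I.smul_of_tower_mem _ he), fun m hm => ?_, fun n hn hnj hl => ?_⟩
        · rw [AddMemClass.coe_add, coe_smul, map_add, hqa m hm, coeff_smul,
            h0 m (by omega), smul_zero, add_zero]
        · have : ((p - (q + coeff j ((p - q : FiveEleven k) : k⟦X⟧) • e) : FiveEleven k) : k⟦X⟧) =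
              ((p - q : FiveEleven k) : k⟦X⟧) -
                coeff j ((p - q : FiveEleven k) : k⟦X⟧) • (e : k⟦X⟧) := by
            rw [← coe_smul, ← AddSubgroupClass.coe_sub, sub_sub]
          rw [this, map_sub, coeff_smul]
          rcases Nat.lt_succ_iff_lt_or_eq.1 hnj with h | rfl
          · rw [hqj n hn h hl, h0 n h, smul_zero, sub_zero]
          · rw [h1, smul_eq_mul, mul_one, sub_self]
      · refine ⟨q, hq, hqa, fun n hn hnj hl => ?_⟩
        rcases Nat.lt_succ_iff_lt_or_eq.1 hnj with h | rfl
        · exact hqj n hn h hl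
        · exact absurd ⟨hn, hl⟩ hj
  -- Finitely many steps suffice: the tail `t` from index N + 40 + a on lies in `I` as a whole by
  -- `mem_of_order`. The summand `a` keeps the tail from touching coefficients below `a`.
  obtain ⟨q, hq, hqa, hqj⟩ := key (N + 40 + a)
  obtain ⟨t, ht⟩ : ∃ t : FiveEleven k, ∀ n, coeff n (t : k⟦X⟧) =
      if N + 40 + a ≤ n then coeff n ((p - q : FiveEleven k) : k⟦X⟧) else 0 :=
    ⟨⟨PowerSeries.mk fun n => if N + 40 + a ≤ n then
      coeff n ((p - q : FiveEleven k) : k⟦X⟧) else 0, mem_of_coeff fun n hn => by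
        rw [coeff_mk, coeff_eq_zero _ hn, ite_self]⟩, fun n => by simp⟩
  refine ⟨q + t, I.add_mem hq (mem_of_order hN fun m hm => ?_), fun m hm => ?_, fun n hn hl => ?_⟩
  · rw [ht, if_neg (by omega)]
  · rw [AddMemClass.coe_add, map_add, hqa m hm, ht, if_neg (by omega), add_zero]
  · rw [← sub_sub, AddSubgroupClass.coe_sub, map_sub, ht]
    split_ifs with h
    · rw [sub_self]
    · rw [hqj n hn (by omega) hl, sub_zero]

/-! ### Maximal ideal, dimension one, parameter ideals -/

theorem mem_maximalIdeal_iff {p : FiveEleven k} :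
    p ∈ IsLocalRing.maximalIdeal (FiveEleven k) ↔ coeff 0 (p : k⟦X⟧) = 0 := by
  rw [IsLocalRing.mem_maximalIdeal, mem_nonunits_iff, coeff_zero_eq_constantCoeff_apply]
  constructor
  · intro h
    by_contra h0
    exact h (isUnit_semigroupRing p h0)
  · intro h hu
    have h1 : IsUnit (constantCoeff (p : k⟦X⟧)) :=
      (hu.map (FiveEleven k).val).map (constantCoeff (R := k))
    rw [h] at h1
    exact not_isUnit_zero h1

theorem isUnit_of_coeff_zero {p : FiveEleven k} (h : coeff 0 (p : k⟦X⟧) ≠ 0) : IsUnit p :=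
  isUnit_semigroupRing p (by rwa [← coeff_zero_eq_constantCoeff_apply])

theorem pow_mem_of_order {I : Ideal (FiveEleven k)} {n : ℕ}
    (hI : ∀ p : FiveEleven k, (∀ m < n, coeff m (p : k⟦X⟧) = 0) → p ∈ I) {p : FiveEleven k}
    (hp : coeff 0 (p : k⟦X⟧) = 0) : p ^ n ∈ I := by
  refine hI _ ?_
  rw [← X_pow_dvd_iff, SubmonoidClass.coe_pow]
  refine pow_dvd_pow_of_dvd ?_ n
  rwa [X_dvd_iff, ← coeff_zero_eq_constantCoeff_apply]

theorem exists_order {p : FiveEleven k} (hp : p ≠ 0) :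
    ∃ n, (∀ m < n, coeff m (p : k⟦X⟧) = 0) ∧ coeff n (p : k⟦X⟧) ≠ 0 := by
  have h : (p : k⟦X⟧) ≠ 0 := fun h => hp (Subtype.ext h)
  exact ⟨_, fun m hm => coeff_of_lt_order_toNat m hm, coeff_order h⟩

theorem maximalIdeal_le_radical {x : FiveEleven k} (hx : x ≠ 0) :
    IsLocalRing.maximalIdeal (FiveEleven k) ≤ (Ideal.span {x}).radical := by
  obtain ⟨n, h0, h1⟩ := exists_order hx
  exact fun p hp => ⟨_, pow_mem_of_order (fun q hq => mem_span_of_order h0 h1 hq)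
    (mem_maximalIdeal_iff.1 hp)⟩

theorem coeff_zero_mono {n : ℕ} (h : 11 * (n % 5) ≤ n) (hn : n ≠ 0) :
    coeff 0 (mono k n h : k⟦X⟧) = 0 := by
  rw [coe_mono, coeff_X_pow, if_neg hn.symm]

theorem ringKrullDim_eq_one : ringKrullDim (FiveEleven k) = 1 := by
  refine ringKrullDim_eq_one_iff_of_isLocalRing_isDomain.2
    ⟨fun h => ?_, fun x hx => maximalIdeal_le_radical hx⟩
  have h5 : 11 * (5 % 5) ≤ 5 := by norm_num
  have h1 : mono k 5 h5 ≠ 0 := fun h => by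
    have := congrArg (fun p : FiveEleven k => coeff 5 (p : k⟦X⟧)) h
    simp [coe_mono, coeff_X_pow] at this
  obtain ⟨y, hy⟩ := h.mul_inv_cancel h1
  have := mem_maximalIdeal_iff.2 (coeff_zero_mono (k := k) h5 (by norm_num))
  exact (IsLocalRing.mem_maximalIdeal _).1 this (IsUnit.of_mul_eq_one _ hy)

theorem radical_eq {I : Ideal (FiveEleven k)} {x : FiveEleven k} (hx : x ≠ 0) (hxI : x ∈ I)
    (hI : ∀ p ∈ I, coeff 0 (p : k⟦X⟧) = 0) :
    I.radical = IsLocalRing.maximalIdeal (FiveEleven k) := by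
  refine le_antisymm ?_ ((maximalIdeal_le_radical hx).trans
    (Ideal.radical_mono ((Ideal.span_singleton_le_iff_mem _).2 hxI)))
  exact (IsLocalRing.maximalIdeal.isMaximal _).isPrime.radical_le_iff.2
    fun p hp => mem_maximalIdeal_iff.2 (hI p hp)

theorem isParameterIdeal_span {x : FiveEleven k} (hx : x ≠ 0) (h0 : coeff 0 (x : k⟦X⟧) = 0) :
    IsParameterIdeal (Ideal.span {x}) := by
  refine ⟨⟨1, fun _ => x, by rw [ringKrullDim_eq_one]; rfl, by rw [Set.range_const]⟩,
    radical_eq hx (Ideal.mem_span_singleton_self x) fun p hp => ?_⟩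
  obtain ⟨q, rfl⟩ := Ideal.mem_span_singleton.1 hp
  rw [coeff_zero_eq_constantCoeff_apply] at h0 ⊢
  rw [MulMemClass.coe_mul, map_mul, h0, zero_mul]

/-! ### Orders of elements of the ideal -/

/-- The leading terms of a pair `f`, `g`:
`f = t ^ 20 + 3 s t ^ 21 + s ^ 2 t ^ 22 + ⋯` and `g = t ^ 26 + 2 s t ^ 27 + ⋯`, with `s ≠ 0`. -/
structure LeadingTerms (s : k) (f g : FiveEleven k) : Prop where
  ne_zero : s ≠ 0
  f_lt : ∀ m < 20, coeff m (f : k⟦X⟧) = 0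
  f20 : coeff 20 (f : k⟦X⟧) = 1
  f21 : coeff 21 (f : k⟦X⟧) = 3 * s
  f22 : coeff 22 (f : k⟦X⟧) = s ^ 2
  g_lt : ∀ m < 26, coeff m (g : k⟦X⟧) = 0
  g26 : coeff 26 (g : k⟦X⟧) = 1
  g27 : coeff 27 (g : k⟦X⟧) = 2 * s

namespace LeadingTerms

variable {s : k} {f g : FiveEleven k} {I : Ideal (FiveEleven k)}

/-- In t^11 f - t^5 g the terms in t^31 cancel, leaving (3s - 2s) t^32 + s² t^33 + ⋯, because 28 is
a gap for g. The coefficient at 33 is recorded as it is needed for the orders 38 and 44 and for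
comparison with g²/f. -/
theorem exists_32 (h : LeadingTerms s f g) (hf : f ∈ I) (hg : g ∈ I) :
    ∃ e ∈ I, (∀ m < 32, coeff m (e : k⟦X⟧) = 0) ∧ coeff 32 (e : k⟦X⟧) = 1 ∧
      coeff 33 (e : k⟦X⟧) = s := by
  have hs := h.ne_zero
  refine ⟨s⁻¹ • (mono k 11 (by norm_num) * f - mono k 5 (by norm_num) * g),
    I.smul_of_tower_mem _ (I.sub_mem (I.mul_mem_left _ hf) (I.mul_mem_left _ hg)), ?_, ?_, ?_⟩
  · intro m hm
    rw [coe_smul, coeff_smul, AddSubgroupClass.coe_sub, map_sub, coeff_mono_mul, coeff_mono_mul]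
    rcases Nat.lt_or_ge m 31 with h1 | h1
    · have e1 : (if 11 ≤ m then coeff (m - 11) (f : k⟦X⟧) else 0) = 0 := by
        split_ifs
        · exact h.f_lt _ (by omega)
        · rfl
      have e2 : (if 5 ≤ m then coeff (m - 5) (g : k⟦X⟧) else 0) = 0 := by
        split_ifs
        · exact h.g_lt _ (by omega)
        · rfl
      rw [e1, e2, sub_zero, smul_zero]
    · obtain rfl : m = 31 := by omega
      norm_num [h.f20, h.g26]
  · rw [coe_smul, coeff_smul, AddSubgroupClass.coe_sub, map_sub, coeff_mono_mul, coeff_mono_mul]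
    norm_num [h.f21, h.g27]
    field_simp
    ring
  · rw [coe_smul, coeff_smul, AddSubgroupClass.coe_sub, map_sub, coeff_mono_mul, coeff_mono_mul]
    norm_num [h.f22, coeff_eq_zero g (n := 28) (by norm_num)]
    field_simp

/-- The same cancellation one step on: with e = t^32 + s t^33 + ⋯, the series t^11 g - t^5 e starts
with (2s - s) t^38. -/
theorem exists_38 (h : LeadingTerms s f g) (hf : f ∈ I) (hg : g ∈ I) :
    ∃ e ∈ I, (∀ m < 38, coeff m (e : k⟦X⟧) = 0) ∧ coeff 38 (e : k⟦X⟧) = 1 := by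
  have hs := h.ne_zero
  obtain ⟨e, he, h0, h1, h2⟩ := h.exists_32 hf hg
  refine ⟨s⁻¹ • (mono k 11 (by norm_num) * g - mono k 5 (by norm_num) * e),
    I.smul_of_tower_mem _ (I.sub_mem (I.mul_mem_left _ hg) (I.mul_mem_left _ he)), ?_, ?_⟩
  · intro m hm
    rw [coe_smul, coeff_smul, AddSubgroupClass.coe_sub, map_sub, coeff_mono_mul, coeff_mono_mul]
    rcases Nat.lt_or_ge m 37 with h3 | h3
    · have e1 : (if 11 ≤ m then coeff (m - 11) (g : k⟦X⟧) else 0) = 0 := by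
        split_ifs
        · exact h.g_lt _ (by omega)
        · rfl
      have e2 : (if 5 ≤ m then coeff (m - 5) (e : k⟦X⟧) else 0) = 0 := by
        split_ifs
        · exact h0 _ (by omega)
        · rfl
      rw [e1, e2, sub_zero, smul_zero]
    · obtain rfl : m = 37 := by omega
      norm_num [h1, h.g26]
  · rw [coe_smul, coeff_smul, AddSubgroupClass.coe_sub, map_sub, coeff_mono_mul, coeff_mono_mul]
    norm_num [h2, h.g27]
    field_simp
    ring

theorem hasLead_44 (h : LeadingTerms s f g) (hf : f ∈ I) (hg : g ∈ I) : HasLead I 44 := by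
  have hs := h.ne_zero
  obtain ⟨e, he, h0, h1, h2⟩ := h.exists_32 hf hg
  obtain ⟨d, hd, d0, d1⟩ := h.exists_38 hf hg
  refine ⟨s⁻¹ • (mono k 11 (by norm_num) * e - mono k 5 (by norm_num) * d),
    I.smul_of_tower_mem _ (I.sub_mem (I.mul_mem_left _ he) (I.mul_mem_left _ hd)), ?_, ?_⟩
  · intro m hm
    rw [coe_smul, coeff_smul, AddSubgroupClass.coe_sub, map_sub, coeff_mono_mul, coeff_mono_mul]
    rcases Nat.lt_or_ge m 43 with h3 | h3
    · have e1 : (if 11 ≤ m then coeff (m - 11) (e : k⟦X⟧) else 0) = 0 := by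
        split_ifs
        · exact h0 _ (by omega)
        · rfl
      have e2 : (if 5 ≤ m then coeff (m - 5) (d : k⟦X⟧) else 0) = 0 := by
        split_ifs
        · exact d0 _ (by omega)
        · rfl
      rw [e1, e2, sub_zero, smul_zero]
    · obtain rfl : m = 43 := by omega
      norm_num [h1, d1]
  · rw [coe_smul, coeff_smul, AddSubgroupClass.coe_sub, map_sub, coeff_mono_mul, coeff_mono_mul]
    norm_num [h2, coeff_eq_zero d (n := 39) (by norm_num)]
    field_simp

/-- The orders 20, 26, 32, 38, 44 represent all residue classes mod 5, so multiplication by powers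
of t^5 (and of t^11) reaches every listed n. -/
theorem hasLead (h : LeadingTerms s f g) (hf : f ∈ I) (hg : g ∈ I) {n : ℕ}
    (hn : n ∈ ({20, 25, 26, 30, 31, 32, 35, 36, 37, 38} : Set ℕ) ∨ 40 ≤ n) : HasLead I n := by
  have h20 : HasLead I 20 := ⟨f, hf, h.f_lt, h.f20⟩
  have h26 : HasLead I 26 := ⟨g, hg, h.g_lt, h.g26⟩
  have h32 : HasLead I 32 := by
    obtain ⟨e, he, h0, h1, -⟩ := h.exists_32 hf hg
    exact ⟨e, he, h0, h1⟩
  have h38 : HasLead I 38 := h.exists_38 hf hg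
  have h44 : HasLead I 44 := h.hasLead_44 hf hg
  have key : ∀ l, HasLead I l → l ≤ n → 11 * ((n - l) % 5) ≤ n - l → HasLead I n := by
    intro l hl hln hm
    have := hl.add (n - l) hm
    rwa [Nat.sub_add_cancel hln] at this
  rcases hn with hn | hn
  · simp only [Set.mem_insert_iff, Set.mem_singleton_iff] at hn
    rcases hn with rfl | rfl | rfl | rfl | rfl | rfl | rfl | rfl | rfl | rfl
    · exact h20
    · exact key 20 h20 (by norm_num) (by norm_num)
    · exact h26
    · exact key 20 h20 (by norm_num) (by norm_num)
    · exact key 20 h20 (by norm_num) (by norm_num)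
    · exact h32
    · exact key 20 h20 (by norm_num) (by norm_num)
    · exact key 20 h20 (by norm_num) (by norm_num)
    · exact key 26 h26 (by norm_num) (by norm_num)
    · exact h38
  · have h5 : n % 5 < 5 := Nat.mod_lt _ (by norm_num)
    interval_cases hr : n % 5
    · exact key 20 h20 (by omega) (by omega)
    · exact key 26 h26 (by omega) (by omega)
    · exact key 32 h32 (by omega) (by omega)
    · exact key 38 h38 (by omega) (by omega)
    · exact key 44 h44 (by omega) (by omega)

end LeadingTerms

end FiveEleven

/-! ### Freeness of the conormal module from relations -/

/-- If the only relations modulo `I ^ 2` between two generators of `I` are those with coefficients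
in `I`, then `I / I ^ 2` is free. -/
theorem free_cotangent_of_span_pair {R : Type*} [CommRing R] {I : Ideal R} {f g : R}
    (hI : I = Ideal.span {f, g}) (h : ∀ x y, x * f + y * g ∈ I ^ 2 → x ∈ I ∧ y ∈ I) :
    Module.Free (R ⧸ I) I.Cotangent := by
  have hf : f ∈ I := by rw [hI]; exact Ideal.subset_span (by simp)
  have hg : g ∈ I := by rw [hI]; exact Ideal.subset_span (by simp)
  let v : Fin 2 → I.Cotangent := ![I.toCotangent ⟨f, hf⟩, I.toCotangent ⟨g, hg⟩]
  have hmk : ∀ (x : R) (c : I.Cotangent), Ideal.Quotient.mk I x • c = x • c := fun x c => rfl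
  have hli : LinearIndependent (R ⧸ I) v := by
    refine LinearIndependent.pair_iff.2 fun a b hab => ?_
    obtain ⟨x, rfl⟩ := Ideal.Quotient.mk_surjective a
    obtain ⟨y, rfl⟩ := Ideal.Quotient.mk_surjective b
    rw [hmk, hmk, ← map_smul, ← map_smul, ← map_add, Ideal.toCotangent_eq_zero] at hab
    exact (h x y hab).imp Ideal.Quotient.eq_zero_iff_mem.2 Ideal.Quotient.eq_zero_iff_mem.2
  refine Module.Free.of_basis (Module.Basis.mk hli fun c _ => ?_)
  obtain ⟨⟨p, hp⟩, rfl⟩ := I.toCotangent_surjective c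
  have hp' := hp
  rw [hI] at hp'
  obtain ⟨x, y, rfl⟩ := Ideal.mem_span_pair.1 hp'
  have : I.toCotangent ⟨x * f + y * g, hp⟩ =
      Ideal.Quotient.mk I x • v 0 + Ideal.Quotient.mk I y • v 1 := by
    rw [hmk, hmk]
    simp only [v, Matrix.cons_val_zero, Matrix.cons_val_one]
    rw [← map_smul, ← map_smul, ← map_add]
    rfl
  rw [this]
  exact Submodule.add_mem _ (Submodule.smul_mem _ _ (Submodule.subset_span ⟨0, rfl⟩))
    (Submodule.smul_mem _ _ (Submodule.subset_span ⟨1, rfl⟩))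

/-! ### Coefficients of the quotient G²/F -/

namespace FiveEleven

variable {k : Type*} [Field k]

theorem coeff_mul_eq_sum_range (n : ℕ) (p q : k⟦X⟧) :
    coeff n (p * q) = ∑ i ∈ Finset.range (n + 1), coeff i p * coeff (n - i) q := by
  rw [coeff_mul, Finset.Nat.sum_antidiagonal_eq_sum_range_succ_mk]

theorem eq_X_pow_mul_of_mul_eq {f g w F G : k⟦X⟧} {a b : ℕ} (hf : f = X ^ a * F)
    (hg : g = X ^ b * G) (hF : constantCoeff F ≠ 0) (hab : a ≤ 2 * b) (h : g * g = f * w) :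
    ∃ W, w = X ^ (2 * b - a) * W ∧ G * G = F * W := by
  have hFW : G * G = F * (F⁻¹ * (G * G)) := by
    rw [← mul_assoc, PowerSeries.mul_inv_cancel F hF, one_mul]
  refine ⟨F⁻¹ * (G * G), ?_, hFW⟩
  have hf0 : f ≠ 0 := by
    rw [hf]
    exact mul_ne_zero (pow_ne_zero _ X_ne_zero) fun h => hF (by rw [h, map_zero])
  refine mul_left_cancel₀ hf0 ?_
  rw [← h, hf, hg]
  have e : (X : k⟦X⟧) ^ b * X ^ b = X ^ a * X ^ (2 * b - a) := by
    rw [← pow_add, ← pow_add]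
    congr 1
    omega
  linear_combination (G * G) * e + X ^ a * X ^ (2 * b - a) * hFW

theorem coeff_quotient_one {F G W : k⟦X⟧} {a b c : k} (hF0 : coeff 0 F = 1) (hF1 : coeff 1 F = a)
    (hF2 : coeff 2 F = b) (hG0 : coeff 0 G = 1) (hG1 : coeff 1 G = c) (hG2 : coeff 2 G = 0)
    (h : G * G = F * W) :
    coeff 0 W = 1 ∧ coeff 1 W = 2 * c - a ∧ coeff 2 W = (c - a) ^ 2 - b := by
  have e0 := congrArg (coeff 0) h
  have e1 := congrArg (coeff 1) h
  have e2 := congrArg (coeff 2) h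
  simp only [coeff_mul_eq_sum_range, Finset.sum_range_succ, Finset.sum_range_zero, Nat.sub_self,
    Nat.sub_zero, Nat.reduceSub, Nat.reduceAdd, hF0, hF1, hF2, hG0, hG1, hG2] at e0 e1 e2
  have w0 : coeff 0 W = 1 := by linear_combination -e0
  have w1 : coeff 1 W = 2 * c - a := by linear_combination -e1 - a * w0
  refine ⟨w0, w1, ?_⟩
  linear_combination -e2 - a * w1 - b * w0

/-- Up to degree 6, W is (1 + 2sX)²/(1 + 3sX + s²X²), so its coefficients satisfy W_j = -3s W_{j-1}
- s² W_{j-2} for 3 ≤ j ≤ 6. Starting from W_1 = s, W_2 = 0 this yields the Fibonacci numbers 1, 3,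
8, 21 with alternating signs; the next one is 55, and c, d enter only in degree 7. -/
theorem coeff_quotient_seven {F G W : k⟦X⟧} {s c d : k} (hF0 : coeff 0 F = 1)
    (hF1 : coeff 1 F = 3 * s) (hF2 : coeff 2 F = s ^ 2)
    (hF : ∀ j, 3 ≤ j → j ≤ 6 → coeff j F = 0) (hF7 : coeff 7 F = c)
    (hG0 : coeff 0 G = 1) (hG1 : coeff 1 G = 2 * s)
    (hG : ∀ j, 2 ≤ j → j ≤ 6 → coeff j G = 0) (hG7 : coeff 7 G = d)
    (h : G * G = F * W) : coeff 7 W = 2 * d - c - 55 * s ^ 7 := by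
  obtain ⟨w0, w1, w2⟩ := coeff_quotient_one hF0 hF1 hF2 hG0 hG1 (hG 2 le_rfl (by norm_num)) h
  have F3 := hF 3 (by norm_num) (by norm_num)
  have F4 := hF 4 (by norm_num) (by norm_num)
  have F5 := hF 5 (by norm_num) (by norm_num)
  have F6 := hF 6 (by norm_num) (by norm_num)
  have G2 := hG 2 (by norm_num) (by norm_num)
  have G3 := hG 3 (by norm_num) (by norm_num)
  have G4 := hG 4 (by norm_num) (by norm_num)
  have G5 := hG 5 (by norm_num) (by norm_num)
  have G6 := hG 6 (by norm_num) (by norm_num)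
  have e3 := congrArg (coeff 3) h
  have e4 := congrArg (coeff 4) h
  have e5 := congrArg (coeff 5) h
  have e6 := congrArg (coeff 6) h
  have e7 := congrArg (coeff 7) h
  simp only [coeff_mul_eq_sum_range, Finset.sum_range_succ, Finset.sum_range_zero, Nat.sub_self,
    Nat.sub_zero, Nat.reduceSub, Nat.reduceAdd, hF0, hF1, hF2, hG0, hG1, F3, F4, F5, F6, hF7,
    G2, G3, G4, G5, G6, hG7, w0, w1, w2] at e3 e4 e5 e6 e7
  have w3 : coeff 3 W = -s ^ 3 := by linear_combination -e3
  have w4 : coeff 4 W = 3 * s ^ 4 := by linear_combination -e4 - 3 * s * w3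
  have w5 : coeff 5 W = -8 * s ^ 5 := by linear_combination -e5 - 3 * s * w4 - s ^ 2 * w3
  have w6 : coeff 6 W = 21 * s ^ 6 := by linear_combination -e6 - 3 * s * w5 - s ^ 2 * w4
  linear_combination -e7 - 3 * s * w6 - s ^ 2 * w5

/-! ### Self-duality of the ideal and the Ulrich property -/

namespace LeadingTerms

variable {s : k} {f g : FiveEleven k} {I : Ideal (FiveEleven k)}

/-- The exponent 33 is the only semigroup element from 32 on that `hasLead` does not supply.
Subtracting the element of `exists_32` removes the terms at 32 and 33 together; the rest can be
cleared. -/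
theorem mem_of_coeff (h : LeadingTerms s f g) (hf : f ∈ I) (hg : g ∈ I) (p : FiveEleven k)
    (hp : ∀ n < 32, coeff n (p : k⟦X⟧) = 0) (hp32 : coeff 32 (p : k⟦X⟧) = 1)
    (hp33 : coeff 33 (p : k⟦X⟧) = s) : p ∈ I := by
  obtain ⟨e, he, e0, e32, e33⟩ := h.exists_32 hf hg
  obtain ⟨q, hq, hq0, hpq⟩ := exists_reduction (h.hasLead hf hg (n := 20) (by simp)) (p - e) 34
  have : p = e + q := by
    rw [← sub_eq_iff_eq_add', ← sub_eq_zero]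
    refine Subtype.ext <| PowerSeries.ext fun n => ?_
    rw [ZeroMemClass.coe_zero, map_zero]
    rcases Nat.lt_or_ge n 34 with hn | hn
    · rw [AddSubgroupClass.coe_sub, map_sub, hq0 n hn, sub_zero, AddSubgroupClass.coe_sub, map_sub]
      rcases Nat.lt_or_ge n 32 with hn' | hn'
      · rw [hp n hn', e0 n hn', sub_zero]
      · obtain rfl | rfl : n = 32 ∨ n = 33 := by omega
        · rw [hp32, e32, sub_self]
        · rw [hp33, e33, sub_self]
    · by_cases hgap : n < 11 * (n % 5)
      · exact coeff_eq_zero _ hgap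
      · refine hpq n hn (h.hasLead hf hg ?_)
        simp only [Set.mem_insert_iff, Set.mem_singleton_iff]
        omega
  rw [this]
  exact I.add_mem he hq

/-- Gorenstein duality in terms of orders. If p were not in I, its reduction modulo I would have an
order n outside the list of `hasLead`. Then 59 - n is in the list, and multiplying by an element of
I of that order and dividing by f gives an element of A of order 59 - 20 = 39, a gap. -/
theorem mem_of_mul_mem (h : LeadingTerms s f g) (hf : f ∈ I) (hg : g ∈ I)
    (hI : I * I ≤ Ideal.span {f}) {p : FiveEleven k} (hp : ∀ e ∈ I, p * e ∈ Ideal.span {f}) :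
    p ∈ I := by
  obtain ⟨q, hq, -, hpq⟩ := exists_reduction (h.hasLead hf hg (n := 20) (by simp)) p 0
  by_contra hpI
  have hne : p - q ≠ 0 := fun h0 => hpI (by rw [sub_eq_zero.1 h0]; exact hq)
  obtain ⟨n, hn0, hn⟩ := exists_order hne
  have hnH : ¬ n < 11 * (n % 5) := fun hlt => hn (coeff_eq_zero _ hlt)
  have hnL : ¬ (n ∈ ({20, 25, 26, 30, 31, 32, 35, 36, 37, 38} : Set ℕ) ∨ 40 ≤ n) :=
    fun hl => hn (hpq n (Nat.zero_le _) (h.hasLead hf hg hl))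
  obtain ⟨e, he, he0, he1⟩ : HasLead I (59 - n) := by
    refine h.hasLead hf hg ?_
    simp only [Set.mem_insert_iff, Set.mem_singleton_iff] at hnL ⊢
    omega
  have hmem : (p - q) * e ∈ Ideal.span {f} := by
    rw [sub_mul]
    exact Ideal.sub_mem _ (hp e he) (hI (Ideal.mul_mem_mul hq he))
  obtain ⟨z, hz⟩ := Ideal.mem_span_singleton.1 hmem
  obtain ⟨F, hF, hFc⟩ := eq_X_pow_mul h.f_lt
  obtain ⟨U, hU, hUc⟩ := eq_X_pow_mul hn0
  obtain ⟨E, hE, hEc⟩ := eq_X_pow_mul he0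
  have hF0 : constantCoeff F = 1 := by
    rw [← coeff_zero_eq_constantCoeff_apply, hFc]; exact h.f20
  have hz' : (z : k⟦X⟧) = X ^ 39 * (F⁻¹ * (U * E)) := by
    have hz1 : ((p - q : FiveEleven k) : k⟦X⟧) * (e : k⟦X⟧) = (f : k⟦X⟧) * (z : k⟦X⟧) :=
      congrArg Subtype.val hz
    rw [hU, hE, hF] at hz1
    have hX : (X : k⟦X⟧) ^ n * X ^ (59 - n) = X ^ 20 * X ^ 39 := by
      rw [← pow_add, ← pow_add]
      congr 1
      omega
    have hFi := PowerSeries.mul_inv_cancel F (by rw [hF0]; exact one_ne_zero)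
    refine mul_left_cancel₀ (pow_ne_zero 20 (X_ne_zero (R := k))) ?_
    linear_combination (-F⁻¹) * hz1 + F⁻¹ * U * E * hX - X ^ 20 * (z : k⟦X⟧) * hFi
  have h39 := coeff_eq_zero z (n := 39) (by norm_num)
  rw [hz', coeff_X_pow_mul', if_pos le_rfl, Nat.sub_self, coeff_zero_eq_constantCoeff_apply,
    map_mul, map_mul, constantCoeff_inv, hF0, ← coeff_zero_eq_constantCoeff_apply,
    ← coeff_zero_eq_constantCoeff_apply, hUc, hEc, add_zero, add_zero, he1, inv_one, one_mul,
    mul_one] at h39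
  exact hn h39

/-- A relation xf + yg ∈ fI makes yg a multiple of f, hence yI ⊆ (f) and y ∈ I by duality. Then yg ∈
I² = fI, and cancelling f gives x ∈ I. -/
theorem free_cotangent (h : LeadingTerms s f g) (hI : I = Ideal.span {f, g})
    (hI2 : I ^ 2 = Ideal.span {f} * I) : Module.Free (FiveEleven k ⧸ I) I.Cotangent := by
  have hf : f ∈ I := by rw [hI]; exact Ideal.subset_span (by simp)
  have hg : g ∈ I := by rw [hI]; exact Ideal.subset_span (by simp)
  have hf0 : f ≠ 0 := by
    rintro rfl
    exact one_ne_zero (h.f20.symm.trans (by simp))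
  have hII : I * I ≤ Ideal.span {f} := by
    rw [← pow_two, hI2]
    exact Ideal.mul_le_left
  refine free_cotangent_of_span_pair hI fun x y hxy => ?_
  rw [hI2] at hxy
  obtain ⟨i, hi, hie⟩ := Ideal.mem_span_singleton_mul.1 hxy
  have hy : y ∈ I := by
    refine h.mem_of_mul_mem hf hg hII fun e he => ?_
    rw [hI] at he
    obtain ⟨c, d, rfl⟩ := Ideal.mem_span_pair.1 he
    -- From xf + yg = fi one has yg = f(i - x), so y(cf + dg) is divisible by f with this quotient.
    refine Ideal.mem_span_singleton.2 ⟨c * y - d * (x - i), ?_⟩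
    linear_combination -d * hie
  have hyg : y * g ∈ I ^ 2 := by
    rw [pow_two]
    exact Ideal.mul_mem_mul hy hg
  rw [hI2] at hyg
  obtain ⟨j, hj, hje⟩ := Ideal.mem_span_singleton_mul.1 hyg
  have hx : x = i - j := mul_left_cancel₀ hf0 (by linear_combination -hie + hje)
  rw [hx]
  exact ⟨I.sub_mem hi hj, hy⟩

theorem order_f (h : LeadingTerms s f g) : (f : k⟦X⟧).order = (20 : ℕ) :=
  order_eq_nat.2 ⟨by rw [h.f20]; exact one_ne_zero, h.f_lt⟩

theorem order_g (h : LeadingTerms s f g) : (g : k⟦X⟧).order = (26 : ℕ) :=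
  order_eq_nat.2 ⟨by rw [h.g26]; exact one_ne_zero, h.g_lt⟩

theorem possessesData (h : LeadingTerms s f g) (hI : I = Ideal.span {f, g})
    (hI2 : I ^ 2 = Ideal.span {f} * I) : PossessesData I 20 26 := by
  refine ⟨f, g, hI, hI2, h.order_f, h.order_g, by norm_num, ?_⟩
  rintro ⟨p, hp, hord⟩
  exact (order_eq_nat.1 hord).1 (coeff_eq_zero ⟨p, hp⟩ (by norm_num))

theorem isUlrichIdeal (h : LeadingTerms s f g) (hI : I = Ideal.span {f, g})
    (hI2 : I ^ 2 = Ideal.span {f} * I) : IsUlrichIdeal I := by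
  have hf : f ∈ I := by rw [hI]; exact Ideal.subset_span (by simp)
  have hg : g ∈ I := by rw [hI]; exact Ideal.subset_span (by simp)
  have hf0 : f ≠ 0 := by
    rintro rfl
    exact one_ne_zero (h.f20.symm.trans (by simp))
  have hfc := h.f_lt 0 (by norm_num)
  have hgc := h.g_lt 0 (by norm_num)
  refine ⟨radical_eq hf0 hf fun p hp => ?_, ⟨Ideal.span {f},
    isParameterIdeal_span hf0 hfc, (Ideal.span_singleton_le_iff_mem _).2 hf, fun hIf => ?_, hI2⟩,
    h.free_cotangent hI hI2⟩
  · rw [hI] at hp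
    obtain ⟨x, y, rfl⟩ := Ideal.mem_span_pair.1 hp
    rw [coeff_zero_eq_constantCoeff_apply] at hfc hgc ⊢
    simp [hfc, hgc]
  -- If I = (f), then g/f would be an element of A of order 6, a gap.
  · rw [hIf] at hg
    obtain ⟨z, hz⟩ := Ideal.mem_span_singleton.1 hg
    obtain ⟨F, hF, hFc⟩ := eq_X_pow_mul h.f_lt
    have hF0 : constantCoeff F = 1 := by
      rw [← coeff_zero_eq_constantCoeff_apply, hFc]; exact h.f20
    have hz1 : (g : k⟦X⟧) = (f : k⟦X⟧) * (z : k⟦X⟧) := congrArg Subtype.val hz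
    have hord := h.order_g
    rw [hz1, order_mul, h.order_f] at hord
    have hz6 : (z : k⟦X⟧).order = (6 : ℕ) := by
      cases hzo : (z : k⟦X⟧).order with
      | top => rw [hzo] at hord; simp at hord
      | coe m =>
        rw [hzo] at hord
        norm_cast at hord ⊢
        omega
    exact (order_eq_nat.1 hz6).1 (coeff_eq_zero z (by norm_num))

end LeadingTerms

/-- The leading terms of generators in normal form. -/
theorem leadingTerms_of_normalForm {α β γ δ ε τ : k} (hne : ε ≠ α)
    (h3 : 3 * ε = 2 * α) (hβ : β = α ^ 2 - 2 * ε ^ 2) {f g : FiveEleven k}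
    (hf : (f : k⟦X⟧) = X ^ 20 + C α * X ^ 21 + C β * X ^ 22 + C γ * X ^ 27 + C δ * X ^ 33)
    (hg : (g : k⟦X⟧) = X ^ 26 + C ε * X ^ 27 + C τ * X ^ 33) :
    LeadingTerms (α - ε) f g where
  ne_zero := sub_ne_zero.2 hne.symm
  f_lt m hm := by
    rw [hf]
    simp only [map_add, coeff_C_mul, coeff_X_pow]
    rw [if_neg, if_neg, if_neg, if_neg, if_neg] <;> first | omega | simp
  f20 := by rw [hf]; simp [coeff_X_pow]
  f21 := by
    rw [hf]
    simp [coeff_X_pow]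
    linear_combination h3
  f22 := by
    rw [hf]
    simp [coeff_X_pow]
    linear_combination hβ - ε * h3
  g_lt m hm := by
    rw [hg]
    simp only [map_add, coeff_C_mul, coeff_X_pow]
    rw [if_neg, if_neg, if_neg] <;> first | omega | simp
  g26 := by rw [hg]; simp [coeff_X_pow]
  g27 := by
    rw [hg]
    simp [coeff_X_pow]
    linear_combination h3

/-! ### The quotient g²/f for generators in normal form -/

namespace LeadingTerms

variable {s : k} {f g : FiveEleven k} {I : Ideal (FiveEleven k)}

/-- The condition on the coefficients for `f` to divide `g ^ 2`, for generators in normal form. -/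
theorem coeff_seven (h : LeadingTerms s f g)
    (hf : ∀ n, n ∈ ({25, 26} : Set ℕ) → coeff n (f : k⟦X⟧) = 0)
    (hg : ∀ n, n ∈ ({30, 31, 32} : Set ℕ) → coeff n (g : k⟦X⟧) = 0)
    {w : k⟦X⟧} (hw : (g : k⟦X⟧) * g = f * w) :
    (∀ n < 32, coeff n w = 0) ∧ coeff 32 w = 1 ∧ coeff 33 w = s ∧ coeff 34 w = 0 ∧
      coeff 39 w = 2 * coeff 33 (g : k⟦X⟧) - coeff 27 (f : k⟦X⟧) - 55 * s ^ 7 := by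
  obtain ⟨F, hF, hFc⟩ := eq_X_pow_mul h.f_lt
  obtain ⟨G, hG, hGc⟩ := eq_X_pow_mul h.g_lt
  have hF0 : constantCoeff F = 1 := by
    rw [← coeff_zero_eq_constantCoeff_apply, hFc]; exact h.f20
  obtain ⟨W, rfl, hW⟩ := eq_X_pow_mul_of_mul_eq hF hG (by rw [hF0]; exact one_ne_zero)
    (by norm_num) hw
  have F0 : coeff 0 F = 1 := by rw [hFc]; exact h.f20
  have F1 : coeff 1 F = 3 * s := by rw [hFc]; exact h.f21
  have F2 : coeff 2 F = s ^ 2 := by rw [hFc]; exact h.f22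
  have G0 : coeff 0 G = 1 := by rw [hGc]; exact h.g26
  have G1 : coeff 1 G = 2 * s := by rw [hGc]; exact h.g27
  have hF36 : ∀ j, 3 ≤ j → j ≤ 6 → coeff j F = 0 := by
    intro j h1 h2
    rw [hFc]
    by_cases hj : j ≤ 4
    · exact coeff_eq_zero f (by omega)
    · refine hf _ ?_
      simp only [Set.mem_insert_iff, Set.mem_singleton_iff]
      omega
  have hG26 : ∀ j, 2 ≤ j → j ≤ 6 → coeff j G = 0 := by
    intro j h1 h2
    rw [hGc]
    by_cases hj : j ≤ 3
    · exact coeff_eq_zero g (by omega)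
    · refine hg _ ?_
      simp only [Set.mem_insert_iff, Set.mem_singleton_iff]
      omega
  obtain ⟨w0, w1, w2⟩ := coeff_quotient_one F0 F1 F2 G0 G1 (hG26 2 le_rfl (by norm_num)) hW
  have w7 := coeff_quotient_seven F0 F1 F2 hF36 (hFc 7) G0 G1 hG26 (hGc 7) hW
  refine ⟨fun n hn => ?_, ?_, ?_, ?_, ?_⟩
  · rw [coeff_X_pow_mul', if_neg (by omega)]
  all_goals
    rw [coeff_X_pow_mul', if_pos (by norm_num)]
    norm_num
  · rw [← coeff_zero_eq_constantCoeff_apply, w0]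
  · rw [w1]; ring
  · rw [w2]; ring
  · rw [w7]

/-- Only g² ∈ fI needs an argument, that is, w = g²/f ∈ I. Since w has order 32, membership in A is
obstructed only by the gaps 34 and 39; the first coefficient vanishes by the leading terms, the
second by `h7`. Finally w = t^32 + s t^33 + ⋯ lies in I by `mem_of_coeff`. -/
theorem sq_eq (h : LeadingTerms s f g) (hI : I = Ideal.span {f, g})
    (hf : ∀ n, n ∈ ({25, 26} : Set ℕ) → coeff n (f : k⟦X⟧) = 0)
    (hg : ∀ n, n ∈ ({30, 31, 32} : Set ℕ) → coeff n (g : k⟦X⟧) = 0)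
    (h7 : coeff 27 (f : k⟦X⟧) = 2 * coeff 33 (g : k⟦X⟧) - 55 * s ^ 7) :
    I ^ 2 = Ideal.span {f} * I := by
  have hfI : f ∈ I := by rw [hI]; exact Ideal.subset_span (by simp)
  have hgI : g ∈ I := by rw [hI]; exact Ideal.subset_span (by simp)
  obtain ⟨F, hF, hFc⟩ := eq_X_pow_mul h.f_lt
  obtain ⟨G, hG, hGc⟩ := eq_X_pow_mul h.g_lt
  have hF0 : constantCoeff F = 1 := by
    rw [← coeff_zero_eq_constantCoeff_apply, hFc]; exact h.f20
  have hFi := PowerSeries.mul_inv_cancel F (by rw [hF0]; exact one_ne_zero)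
  obtain ⟨w, hw⟩ : ∃ w : k⟦X⟧, (g : k⟦X⟧) * g = f * w := by
    refine ⟨X ^ 32 * (F⁻¹ * (G * G)), ?_⟩
    rw [hF, hG]
    linear_combination (-X ^ 52 * G * G) * hFi
  obtain ⟨w0, w32, w33, w34, w39⟩ := h.coeff_seven hf hg hw
  have hwA : w ∈ FiveEleven k := FiveEleven.mem_of_coeff fun n hn => by
    rcases Nat.lt_or_ge n 32 with h1 | h1
    · exact w0 n h1
    · obtain rfl | rfl : n = 34 ∨ n = 39 := by omega
      · exact w34
      · rw [w39, h7]; ring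
  have hwI := h.mem_of_coeff hfI hgI ⟨w, hwA⟩ w0 w32 w33
  have hgg : g * g = f * ⟨w, hwA⟩ := Subtype.ext hw
  refine le_antisymm ?_ ?_
  · rw [pow_two]
    nth_rewrite 1 2 [hI]
    rw [Ideal.span_mul_span', Ideal.span_le]
    rintro _ ⟨a, ha, b, hb, rfl⟩
    have hpair : ∀ c ∈ ({f, g} : Set (FiveEleven k)), c ∈ I := fun c hc => by
      rw [hI]; exact Ideal.subset_span hc
    rcases ha with rfl | rfl
    · exact Ideal.mem_span_singleton_mul.2 ⟨b, hpair b hb, rfl⟩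
    · rcases hb with rfl | rfl
      · exact Ideal.mem_span_singleton_mul.2 ⟨a, hgI, mul_comm _ _⟩
      · exact Ideal.mem_span_singleton_mul.2 ⟨_, hwI, hgg.symm⟩
  · rw [pow_two]
    exact Ideal.mul_mono_left ((Ideal.span_singleton_le_iff_mem _).2 hfI)

end LeadingTerms

/-! ### Necessity: leading terms and reduction to normal form -/

/-- If `f = t ^ 20 + ⋯` and `g = t ^ 26 + ⋯` satisfy an equation `g ^ 2 = f (r f + t g)`, then their
leading terms are determined by a single parameter. -/
theorem leadingTerms_of_sq_eq {f g r t : FiveEleven k} (hf : ∀ m < 20, coeff m (f : k⟦X⟧) = 0)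
    (hf20 : coeff 20 (f : k⟦X⟧) = 1) (hg : ∀ m < 26, coeff m (g : k⟦X⟧) = 0)
    (hg26 : coeff 26 (g : k⟦X⟧) = 1) (h : g * g = f * (r * f + t * g)) :
    (∃ s, LeadingTerms s f g) ∧ coeff 0 (r : k⟦X⟧) = 0 ∧ coeff 0 (t : k⟦X⟧) = 0 := by
  obtain ⟨F, hF, hFc⟩ := eq_X_pow_mul hf
  obtain ⟨G, hG, hGc⟩ := eq_X_pow_mul hg
  have hF0 : constantCoeff F = 1 := by
    rw [← coeff_zero_eq_constantCoeff_apply, hFc]; exact hf20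
  have h' : (g : k⟦X⟧) * g = f * (r * f + t * g) := congrArg Subtype.val h
  obtain ⟨W, hW, hGW⟩ := eq_X_pow_mul_of_mul_eq hF hG (by rw [hF0]; exact one_ne_zero)
    (by norm_num) h'
  have F0 : coeff 0 F = 1 := by rw [hFc]; exact hf20
  have F3 : coeff 3 F = 0 := by rw [hFc]; exact coeff_eq_zero f (by norm_num)
  have G0 : coeff 0 G = 1 := by rw [hGc]; exact hg26
  have G2 : coeff 2 G = 0 := by rw [hGc]; exact coeff_eq_zero g (by norm_num)
  obtain ⟨w0, w1, w2⟩ := coeff_quotient_one F0 rfl rfl G0 rfl G2 hGW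
  -- This is the coefficient of g²/f = rf + tg ∈ A at 32 + 2 = 34, a gap.
  have w2' : coeff 2 W = 0 := by
    have := coeff_eq_zero (r * f + t * g) (n := 34) (by norm_num)
    rw [AddMemClass.coe_add, MulMemClass.coe_mul, MulMemClass.coe_mul, hW, coeff_X_pow_mul'] at this
    simpa using this
  have key : (r : k⟦X⟧) * F + X ^ 6 * ((t : k⟦X⟧) * G) = X ^ 12 * W := by
    refine mul_left_cancel₀ (pow_ne_zero 20 (X_ne_zero (R := k))) ?_
    rw [hF, hG] at hW
    linear_combination hW
  have gap : ∀ (p : FiveEleven k) (n : ℕ), n < 11 * (n % 5) → coeff n (p : k⟦X⟧) = 0 :=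
    fun p n hn => coeff_eq_zero p hn
  have c : ∀ n, coeff n ((r : k⟦X⟧) * F) + (if 6 ≤ n then coeff (n - 6) ((t : k⟦X⟧) * G) else 0) =
      if 12 ≤ n then coeff (n - 12) W else 0 := by
    intro n
    rw [← coeff_X_pow_mul', ← coeff_X_pow_mul', ← key, map_add]
  have c0 := c 0
  have c5 := c 5
  have c6 := c 6
  have c10 := c 10
  have c11 := c 11
  have c12 := c 12
  have c13 := c 13
  clear c
  simp only [coeff_mul_eq_sum_range, Finset.sum_range_succ, Finset.sum_range_zero, Nat.sub_self,
    Nat.sub_zero, Nat.reduceSub, Nat.reduceAdd, Nat.reduceLeDiff, if_true, if_false, F0, F3, G0, G2,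
    gap r 1 (by norm_num), gap r 2 (by norm_num), gap r 3 (by norm_num), gap r 4 (by norm_num),
    gap r 6 (by norm_num), gap r 7 (by norm_num), gap r 8 (by norm_num), gap r 9 (by norm_num),
    gap r 12 (by norm_num), gap r 13 (by norm_num), gap t 1 (by norm_num), gap t 2 (by norm_num),
    gap t 3 (by norm_num), gap t 4 (by norm_num), gap t 6 (by norm_num), gap t 7 (by norm_num),
    zero_mul, mul_zero, zero_add, add_zero, mul_one] at c0 c5 c6 c10 c11 c12 c13
  have r0 : coeff 0 (r : k⟦X⟧) = 0 := by simpa using c0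
  have r5 : coeff 5 (r : k⟦X⟧) = 0 := by simpa [r0] using c5
  have t0 : coeff 0 (t : k⟦X⟧) = 0 := by simpa [r0, r5] using c6
  have r10 : coeff 10 (r : k⟦X⟧) = 0 := by simpa [r0, r5, t0] using c10
  simp only [r0, r5, t0, r10, zero_mul, zero_add, add_zero, w0, w1] at c11 c12 c13
  rw [w2'] at w2
  set a := coeff 1 F with ha
  set b := coeff 2 F with hb
  set e := coeff 1 G with he
  set u := coeff 11 (r : k⟦X⟧) with hu
  -- Degrees 11, 12, 13 of rF + X^6 tG = X^12 W read u + t_5 = 0, ua + t_5 e = 1 and ub = 2e - a,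
  -- with t_5 the coefficient of `t` at 5. Together with b = (a - e)² they force a - e = 2e - a.
  have hua : u * (a - e) = 1 := by linear_combination c12 - e * c11
  have hne : a - e ≠ 0 := fun h0 => by rw [h0, mul_zero] at hua; exact zero_ne_one hua
  have hbe : b = (2 * e - a) * (a - e) := by linear_combination (a - e) * c13 - b * hua
  have hae : a - e = 2 * e - a := by
    refine mul_right_cancel₀ hne ?_
    linear_combination hbe - w2
  refine ⟨⟨a - e, hne, hf, hf20, ?_, ?_, hg, hg26, ?_⟩, r0, t0⟩
  · have : coeff 21 (f : k⟦X⟧) = a := (hFc 1).symm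
    rw [this]
    linear_combination -hae
  · have : coeff 22 (f : k⟦X⟧) = b := (hFc 2).symm
    rw [this]
    linear_combination w2
  · have : coeff 27 (g : k⟦X⟧) = e := (hGc 1).symm
    rw [this]
    linear_combination -hae

theorem coeff_zero_mul (p q : k⟦X⟧) : coeff 0 (p * q) = coeff 0 p * coeff 0 q := by
  simp only [coeff_zero_eq_constantCoeff_apply, map_mul]

/-- If `(f, g) ^ 2 = f (f, g)`, then `(f, g) ^ 2 ⊆ (f')` also for `f' = (1 - x) f - y g`, provided the
norm of `f' / f` is a unit. -/
theorem sq_le_span_of_unit {R : Type*} [CommRing R] [IsDomain R] {f g r t x y : R} {I : Ideal R}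
    (hI : I = Ideal.span {f, g}) (hI2 : I ^ 2 = Ideal.span {f} * I) (hf : f ≠ 0)
    (hg : g * g = f * (r * f + t * g))
    (hu : IsUnit ((1 - x) * (1 - x - y * t) - y ^ 2 * r)) :
    I * I ≤ Ideal.span {(1 - x) * f - y * g} := by
  intro p hp
  rw [← pow_two, hI2] at hp
  obtain ⟨z, hz, rfl⟩ := Ideal.mem_span_singleton_mul.1 hp
  -- With θ = g/f one has θ² = r + tθ, and the factor here is f times the conjugate of (1 - x) - yθ.
  -- Their product is the norm in `hu`, so f'/f is invertible in A[θ] = I/f.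
  have he : ((1 - x - y * t) * f + y * g) * z ∈ I ^ 2 := by
    rw [pow_two]
    refine Ideal.mul_mem_mul ?_ hz
    rw [hI]
    exact Ideal.mem_span_pair.2 ⟨_, _, rfl⟩
  rw [hI2] at he
  obtain ⟨z', -, hz'⟩ := Ideal.mem_span_singleton_mul.1 he
  obtain ⟨u, hu⟩ := hu
  refine Ideal.mem_span_singleton.2 ⟨z' * ↑u⁻¹, ?_⟩
  rw [← mul_assoc, Units.eq_mul_inv_iff_mul_eq, hu]
  refine mul_left_cancel₀ hf ?_
  linear_combination (y ^ 2 * z) * hg - ((1 - x) * f - y * g) * hz'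

namespace LeadingTerms

variable {s : k} {f g : FiveEleven k} {I : Ideal (FiveEleven k)}

/-- The generators of `I` can be brought into normal form. -/
theorem exists_normalForm (h : LeadingTerms s f g) (hI : I = Ideal.span {f, g})
    (hI2 : I ^ 2 = Ideal.span {f} * I) {r t : FiveEleven k}
    (hg : g * g = f * (r * f + t * g)) (hr : coeff 0 (r : k⟦X⟧) = 0)
    (ht : coeff 0 (t : k⟦X⟧) = 0) :
    ∃ f' g' : FiveEleven k, LeadingTerms s f' g' ∧ I = Ideal.span {f', g'} ∧
      I * I ≤ Ideal.span {f'} ∧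
      (∀ n, 25 ≤ n → n ≠ 27 → n ≠ 33 → coeff n (f' : k⟦X⟧) = 0) ∧
      ∀ n, 28 ≤ n → n ≠ 33 → coeff n (g' : k⟦X⟧) = 0 := by
  have hfI : f ∈ I := by rw [hI]; exact Ideal.subset_span (by simp)
  have hgI : g ∈ I := by rw [hI]; exact Ideal.subset_span (by simp)
  have hf0 : f ≠ 0 := by
    rintro rfl
    exact one_ne_zero (h.f20.symm.trans (by simp))
  have h20 := h.hasLead hfI hgI (n := 20) (by simp)
  -- The cutoffs 25 and 30 leave the leading terms intact: f has no exponents 23, 24 and g none at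
  -- 28, 29, since these are gaps.
  obtain ⟨q, hq, hq0, hfq⟩ := exists_reduction h20 f 25
  obtain ⟨q', hq', hq0', hgq⟩ := exists_reduction h20 g 30
  have hq2 := hq
  have hq2' := hq'
  rw [hI] at hq2 hq2'
  obtain ⟨x, y, rfl⟩ := Ideal.mem_span_pair.1 hq2
  obtain ⟨x', y', rfl⟩ := Ideal.mem_span_pair.1 hq2'
  have hfX : ∃ F, (f : k⟦X⟧) = X ^ 20 * F ∧ ∀ j, coeff j F = coeff (20 + j) (f : k⟦X⟧) :=
    eq_X_pow_mul h.f_lt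
  have hgX : ∃ G, (g : k⟦X⟧) = X ^ 26 * G ∧ ∀ j, coeff j G = coeff (26 + j) (g : k⟦X⟧) :=
    eq_X_pow_mul h.g_lt
  obtain ⟨F, hF, hFc⟩ := hfX
  obtain ⟨G, hG, hGc⟩ := hgX
  have F0 : coeff 0 F = 1 := by rw [hFc]; exact h.f20
  have G0 : coeff 0 G = 1 := by rw [hGc]; exact h.g26
  have expand : ∀ (a b : FiveEleven k) (n : ℕ),
      coeff n ((a * f + b * g : FiveEleven k) : k⟦X⟧) =
        (if 20 ≤ n then coeff (n - 20) ((a : k⟦X⟧) * F) else 0) +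
          if 26 ≤ n then coeff (n - 26) ((b : k⟦X⟧) * G) else 0 := by
    intro a b n
    rw [AddMemClass.coe_add, MulMemClass.coe_mul, MulMemClass.coe_mul, hF, hG,
      mul_left_comm, mul_left_comm (b : k⟦X⟧), map_add, coeff_X_pow_mul', coeff_X_pow_mul']
  have gap : ∀ n, n < 11 * (n % 5) → coeff n (x' : k⟦X⟧) = 0 := fun n hn => coeff_eq_zero x' hn
  have x0 : coeff 0 (x : k⟦X⟧) = 0 := by
    have := hq0 20 (by norm_num)
    rw [expand, if_pos le_rfl, if_neg (by norm_num), add_zero, Nat.sub_self, coeff_zero_mul, F0,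
      mul_one] at this
    exact this
  have x0' : coeff 0 (x' : k⟦X⟧) = 0 := by
    have := hq0' 20 (by norm_num)
    rw [expand, if_pos le_rfl, if_neg (by norm_num), add_zero, Nat.sub_self, coeff_zero_mul, F0,
      mul_one] at this
    exact this
  have x5' : coeff 5 (x' : k⟦X⟧) = 0 := by
    have := hq0' 25 (by norm_num)
    rw [expand, if_pos (by norm_num), if_neg (by norm_num), add_zero, coeff_mul_eq_sum_range] at this
    simpa only [Finset.sum_range_succ, Finset.sum_range_zero, Nat.reduceSub, Nat.sub_self, F0, x0',
      gap 1 (by norm_num), gap 2 (by norm_num), gap 3 (by norm_num), gap 4 (by norm_num), zero_mul,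
      zero_add, mul_one] using this
  have y0' : coeff 0 (y' : k⟦X⟧) = 0 := by
    have := hq0' 26 (by norm_num)
    rw [expand, if_pos (by norm_num), if_pos le_rfl, Nat.sub_self, coeff_zero_mul, G0, mul_one,
      coeff_mul_eq_sum_range] at this
    simpa only [Finset.sum_range_succ, Finset.sum_range_zero, Nat.reduceSub, Nat.sub_self, F0, x0',
      x5', gap 1 (by norm_num), gap 2 (by norm_num), gap 3 (by norm_num), gap 4 (by norm_num),
      gap 6 (by norm_num), zero_mul, zero_add, mul_one] using this
  have hone : coeff 0 ((1 : FiveEleven k) : k⟦X⟧) = 1 := by simp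
  -- Determinant of the change of generators. It has constant term 1, since the low coefficients of
  -- the subtracted elements vanish; likewise for the norm below, as r and t have constant term 0.
  have hdet : IsUnit ((1 - x) * (1 - y') - y * x') := by
    refine isUnit_of_coeff_zero ?_
    simp only [AddSubgroupClass.coe_sub, MulMemClass.coe_mul, map_sub, coeff_zero_mul, hone, x0,
      x0', y0']
    norm_num
  have hnorm : IsUnit ((1 - x) * (1 - x - y * t) - y ^ 2 * r) := by
    refine isUnit_of_coeff_zero ?_
    simp only [AddSubgroupClass.coe_sub, MulMemClass.coe_mul, map_sub, coeff_zero_mul, hone, x0,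
      hr, ht]
    norm_num
  have hf' : f - (x * f + y * g) = (1 - x) * f - y * g := by ring
  refine ⟨f - (x * f + y * g), g - (x' * f + y' * g), ?_, ?_, ?_, ?_, ?_⟩
  · have ef : ∀ n < 25, coeff n ((f - (x * f + y * g) : FiveEleven k) : k⟦X⟧) =
        coeff n (f : k⟦X⟧) := fun n hn => by
      rw [AddSubgroupClass.coe_sub, map_sub, hq0 n hn, sub_zero]
    have eg : ∀ n < 30, coeff n ((g - (x' * f + y' * g) : FiveEleven k) : k⟦X⟧) =
        coeff n (g : k⟦X⟧) := fun n hn => by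
      rw [AddSubgroupClass.coe_sub, map_sub, hq0' n hn, sub_zero]
    exact ⟨h.ne_zero, fun m hm => by rw [ef m (by omega), h.f_lt m hm],
      by rw [ef _ (by norm_num), h.f20], by rw [ef _ (by norm_num), h.f21],
      by rw [ef _ (by norm_num), h.f22], fun m hm => by rw [eg m (by omega), h.g_lt m hm],
      by rw [eg _ (by norm_num), h.g26], by rw [eg _ (by norm_num), h.g27]⟩
  · refine le_antisymm ?_ ?_
    · obtain ⟨u, hu⟩ := hdet
      have hinv : (↑u⁻¹ : FiveEleven k) * ((1 - x) * (1 - y') - y * x') = 1 := by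
        rw [← hu, Units.inv_mul]
      rw [hI, Ideal.span_le]
      rintro p (rfl | rfl)
      · refine Ideal.mem_span_pair.2 ⟨↑u⁻¹ * (1 - y'), ↑u⁻¹ * y, ?_⟩
        linear_combination p * hinv
      · refine Ideal.mem_span_pair.2 ⟨↑u⁻¹ * x', ↑u⁻¹ * (1 - x), ?_⟩
        linear_combination p * hinv
    · rw [Ideal.span_le]
      rintro p (rfl | rfl)
      · exact I.sub_mem hfI hq
      · exact I.sub_mem hgI hq'
  · rw [hf']
    exact sq_le_span_of_unit hI hI2 hf0 hg hnorm
  · intro n h1 h2 h3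
    by_cases hgap : n < 11 * (n % 5)
    · exact coeff_eq_zero _ hgap
    · refine hfq n h1 (h.hasLead hfI hgI ?_)
      simp only [Set.mem_insert_iff, Set.mem_singleton_iff]
      omega
  · intro n h1 h2
    by_cases hgap : n < 11 * (n % 5)
    · exact coeff_eq_zero _ hgap
    · refine hgq n (by omega) (h.hasLead hfI hgI ?_)
      simp only [Set.mem_insert_iff, Set.mem_singleton_iff]
      omega

theorem eq_normalForm (h : LeadingTerms s f g)
    (hf : ∀ n, 25 ≤ n → n ≠ 27 → n ≠ 33 → coeff n (f : k⟦X⟧) = 0)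
    (hg : ∀ n, 28 ≤ n → n ≠ 33 → coeff n (g : k⟦X⟧) = 0) :
    (f : k⟦X⟧) = X ^ 20 + C (3 * s) * X ^ 21 + C (s ^ 2) * X ^ 22 +
        C (coeff 27 (f : k⟦X⟧)) * X ^ 27 + C (coeff 33 (f : k⟦X⟧)) * X ^ 33 ∧
      (g : k⟦X⟧) = X ^ 26 + C (2 * s) * X ^ 27 + C (coeff 33 (g : k⟦X⟧)) * X ^ 33 := by
  constructor
  · ext n
    by_cases hn : n ∈ ({20, 21, 22, 27, 33} : Set ℕ)
    · simp only [Set.mem_insert_iff, Set.mem_singleton_iff] at hn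
      rcases hn with rfl | rfl | rfl | rfl | rfl <;>
        simp only [map_add, coeff_C_mul, coeff_X_pow, h.f20, h.f21, h.f22] <;> norm_num
    · simp only [Set.mem_insert_iff, Set.mem_singleton_iff, not_or] at hn
      have h0 : coeff n (f : k⟦X⟧) = 0 := by
        rcases Nat.lt_or_ge n 20 with h1 | h1
        · exact h.f_lt n h1
        · rcases Nat.lt_or_ge n 25 with h2 | h2
          · exact coeff_eq_zero f (by omega)
          · exact hf n h2 (by omega) (by omega)
      rw [h0]
      simp only [map_add, coeff_C_mul, coeff_X_pow]
      simp [hn]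
  · ext n
    by_cases hn : n ∈ ({26, 27, 33} : Set ℕ)
    · simp only [Set.mem_insert_iff, Set.mem_singleton_iff] at hn
      rcases hn with rfl | rfl | rfl <;>
        simp only [map_add, coeff_C_mul, coeff_X_pow, h.g26, h.g27] <;> norm_num
    · simp only [Set.mem_insert_iff, Set.mem_singleton_iff, not_or] at hn
      have h0 : coeff n (g : k⟦X⟧) = 0 := by
        rcases Nat.lt_or_ge n 26 with h1 | h1
        · exact h.g_lt n h1
        · exact hg n (by omega) (by omega)
      rw [h0]
      simp only [map_add, coeff_C_mul, coeff_X_pow]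
      simp [hn]

end LeadingTerms

theorem exists_monic_generators {I : Ideal (FiveEleven k)} (hI : PossessesData I 20 26) :
    ∃ f g : FiveEleven k, I = Ideal.span {f, g} ∧ I ^ 2 = Ideal.span {f} * I ∧
      ((∀ m < 20, coeff m (f : k⟦X⟧) = 0) ∧ coeff 20 (f : k⟦X⟧) = 1) ∧
      (∀ m < 26, coeff m (g : k⟦X⟧) = 0) ∧ coeff 26 (g : k⟦X⟧) = 1 := by
  obtain ⟨f, g, hfg, hI2, hf, hg, -⟩ := hI
  obtain ⟨f1, f0⟩ := order_eq_nat.1 hf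
  obtain ⟨g1, g0⟩ := order_eq_nat.1 hg
  have hunit : ∀ c : k, c ≠ 0 → IsUnit (algebraMap k (FiveEleven k) c) := fun c hc =>
    (isUnit_iff_ne_zero.2 hc).map _
  have hsmul : ∀ (c : k) (p : FiveEleven k), c • p = algebraMap k (FiveEleven k) c * p :=
    fun c p => Algebra.smul_def c p
  have hspan : ∀ (c : k) (p : FiveEleven k), c ≠ 0 → Ideal.span {c • p} = Ideal.span {p} :=
    fun c p hc => by rw [hsmul, Ideal.span_singleton_mul_left_unit (hunit c hc)]
  refine ⟨(coeff 20 (f : k⟦X⟧))⁻¹ • f, (coeff 26 (g : k⟦X⟧))⁻¹ • g, ?_, ?_,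
    ⟨fun m hm => ?_, ?_⟩, fun m hm => ?_, ?_⟩
  · rw [Ideal.span_insert, hspan _ _ (inv_ne_zero f1), hspan _ _ (inv_ne_zero g1),
      ← Ideal.span_insert, hfg]
  · rw [hspan _ _ (inv_ne_zero f1), hI2]
  · rw [coe_smul, coeff_smul, f0 m hm, smul_zero]
  · rw [coe_smul, coeff_smul, smul_eq_mul, inv_mul_cancel₀ f1]
  · rw [coe_smul, coeff_smul, g0 m hm, smul_zero]
  · rw [coe_smul, coeff_smul, smul_eq_mul, inv_mul_cancel₀ g1]

end FiveEleven

/-! ### The classification -/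

theorem mainTheorem4 (k : Type*) [Field k] (hk : ringChar k ≠ 2) :
    {I : Ideal (semigroupRing k (AddSubmonoid.closure {5, 11})) |
        IsUlrichIdeal I ∧ PossessesData I 20 26} =
      {I | ∃ α β γ δ ε τ : k,
        ε ≠ α ∧ 3 * ε = 2 * α ∧ β = α ^ 2 - 2 * ε ^ 2 ∧ γ = 2 * τ - 55 / 128 * ε ^ 7 ∧
        ∃ f g : semigroupRing k (AddSubmonoid.closure {5, 11}),
          (f : k⟦X⟧) = X ^ 20 + C α * X ^ 21 + C β * X ^ 22 + C γ * X ^ 27 + C δ * X ^ 33 ∧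
          (g : k⟦X⟧) = X ^ 26 + C ε * X ^ 27 + C τ * X ^ 33 ∧
          I = Ideal.span {f, g}} := by
  have h2 : (2 : k) ≠ 0 := Ring.two_ne_zero hk
  have h128 : (128 : k) ≠ 0 := by
    have : (128 : k) = 2 ^ 7 := by norm_num
    rw [this]
    exact pow_ne_zero 7 h2
  ext I
  constructor
  · rintro ⟨-, hI⟩
    obtain ⟨f, g, hfg, hI2, ⟨f0, f1⟩, g0, g1⟩ := FiveEleven.exists_monic_generators hI
    have hgg : g * g ∈ I ^ 2 := by
      have hgI : g ∈ I := by rw [hfg]; exact Ideal.subset_span (by simp)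
      rw [pow_two]
      exact Ideal.mul_mem_mul hgI hgI
    rw [hI2] at hgg
    obtain ⟨z, hz, hze⟩ := Ideal.mem_span_singleton_mul.1 hgg
    rw [hfg] at hz
    obtain ⟨r, t, rfl⟩ := Ideal.mem_span_pair.1 hz
    obtain ⟨⟨s, hs⟩, hr, ht⟩ := FiveEleven.leadingTerms_of_sq_eq f0 f1 g0 g1 hze.symm
    obtain ⟨f', g', hs', hI', hII, hf', hg'⟩ := hs.exists_normalForm hfg hI2 hze.symm hr ht
    have hg'I : g' ∈ I := by rw [hI']; exact Ideal.subset_span (by simp)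
    obtain ⟨w, hw⟩ := Ideal.mem_span_singleton.1 (hII (Ideal.mul_mem_mul hg'I hg'I))
    obtain ⟨-, -, -, -, w39⟩ := hs'.coeff_seven (w := (w : k⟦X⟧))
      (fun n hn => by
        simp only [Set.mem_insert_iff, Set.mem_singleton_iff] at hn
        exact hf' n (by omega) (by omega) (by omega))
      (fun n hn => by
        simp only [Set.mem_insert_iff, Set.mem_singleton_iff] at hn
        exact hg' n (by omega) (by omega))
      (congrArg Subtype.val hw)
    -- The gap 39 of w = g'²/f' gives γ = 2τ - 55 s^7; with ε = 2s this is the stated equation, 128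
    -- being 2^7.
    rw [FiveEleven.coeff_eq_zero w (by norm_num)] at w39
    obtain ⟨ef, eg⟩ := hs'.eq_normalForm hf' hg'
    refine ⟨3 * s, s ^ 2, _, _, 2 * s, _, ?_, by ring, by ring, ?_, f', g', ef, eg, hI'⟩
    · intro h
      exact hs.ne_zero (by linear_combination -h)
    · field_simp
      linear_combination 128 * w39
  · rintro ⟨α, β, γ, δ, ε, τ, hne, h3, hβ, hγ, f, g, hf, hg, hI⟩
    have hs := FiveEleven.leadingTerms_of_normalForm hne h3 hβ hf hg
    have hI2 := hs.sq_eq hI (fun n hn => by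
        simp only [Set.mem_insert_iff, Set.mem_singleton_iff] at hn
        rw [hf]
        rcases hn with rfl | rfl <;> simp [coeff_X_pow])
      (fun n hn => by
        simp only [Set.mem_insert_iff, Set.mem_singleton_iff] at hn
        rw [hg]
        rcases hn with rfl | rfl | rfl <;> simp [coeff_X_pow])
      (by
        -- Here s = α - ε, and 3ε = 2α says ε = 2s.
        have hε : ε = 2 * (α - ε) := by linear_combination h3
        have hε7 : ε ^ 7 = 128 * (α - ε) ^ 7 := by
          calc ε ^ 7 = (2 * (α - ε)) ^ 7 := by rw [← hε]
            _ = 128 * (α - ε) ^ 7 := by ring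
        rw [hf, hg]
        simp only [map_add, coeff_C_mul, coeff_X_pow]
        norm_num
        rw [hγ, hε7]
        field_simp)
    exact ⟨hs.isUlrichIdeal hI hI2, hs.possessesData hI hI2⟩
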